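/- \textbf{Strong normalization of the simply typed $\lambda\upsilon$-calculus.} The terms $t$ and substitutions $s$ of the $\lambda\upsilon$-calculus (explicit substitutions with De Bruijn indices $n\ge 1$, without composition of substitutions) are given by $$t ::= n \mid (t\ t) \mid \lambda t \mid t[s], \qquad s ::= t/ \mid\ \Uparrow(s)\ \mid\ \uparrow .$$ One-step reduction $\to_{\lambda\upsilon}$ is the closure under all term and substitution contexts of the rules $$\begin{array}{rcll} (\lambda t)\,u &\to& t[u/] & (B)\\ (t\ u)[s] &\to& (t[s])\ (u[s]) & (\mathit{App})\\ (\lambda t)[s] &\to& \lambda(t[\Uparrow(s)]) & (\mathit{Lambda})\\ 1[t/] &\to& t & (\mathit{FVar})\\ (n+1)[t/] &\to& n & (\mathit{RVar})\\ 1[\Uparrow(s)] &\to& 1 & (\mathit{FVarLift})\\ (n+1)[\Uparrow(s)] &\to& n[s][\uparrow] & (\mathit{RVarLift})\\ n[\uparrow] &\to& n+1 & (\mathit{VarShift}) \end{array}$$ Types are the simple types built from an arbitrary set of atomic types with $\to$; a context is a finite list of types. The typing judgements $\Gamma\vdash t:A$ and $\Gamma\vdash s\triangleright\Gamma'$ are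 defined inductively by the rules: \begin{itemize} \item $\Gamma,A,\Delta\vdash n:A$ if $n=|\Gamma|+1$; \item if $\Gamma\vdash t:B\to A$ and $\Gamma\vdash u:B$, then $\Gamma\vdash (t\ u):A$; \item if $B,\Gamma\vdash t:A$, then $\Gamma\vdash\lambda t:B\to A$; \item if $\Gamma\vdash s\triangleright\Gamma'$ and $\Gamma'\vdash t:A$, then $\Gamma\vdash t[s]:A$; \item if $\Gamma\vdash t:A$, then $\Gamma\vdash t/\triangleright A,\Gamma$; \item $A,\Gamma\vdash\ \uparrow\ \triangleright\ \Gamma$; \item if $\Gamma\vdash s\triangleright\Gamma'$, then $A,\Gamma\vdash\ \Uparrow(s)\triangleright A,\Gamma'$. \end{itemize} \textbf{Theorem.} Every typable term is strongly normalizing: if $\Gamma\vdash t:A$, then there is no infinite sequence $t=t_0\to_{\lambda\upsilon}t_1\to_{\lambda\upsilon}t_2\to_{\lambda\upsilon}\cdots$. -/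

import Mathlib

namespace LambdaUpsilon

universe u

/-! The simply typed calculus of explicit substitutions with De Bruijn indices. -/

mutual

/-- Terms `t ::= n | (t t) | λ t | t[s]`. De Bruijn indices are usually numbered from `1` in this
calculus; here `var n` (with `n : ℕ`) stands for the index `n + 1`. -/
inductive Term : Type
  | var (n : ℕ) : Term
  | app (t u : Term) : Term
  | lam (t : Term) : Term
  | clos (t : Term) (s : Subst) : Term

/-- Substitutions `s ::= t/ | ⇑(s) | ↑`. -/
inductive Subst : Type
  | slash (t : Term) : Subst
  | lift (s : Subst) : Subst
  | shift : Subst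

end

open Term Subst

/-- The reduction rules, applied at the root of a term. -/
inductive Rule : Term → Term → Prop
  /-- `(λ t) u → t[u/]` -/
  | B (t u : Term) : Rule (app (lam t) u) (clos t (slash u))
  /-- `(t u)[s] → (t[s]) (u[s])` -/
  | App (t u : Term) (s : Subst) : Rule (clos (app t u) s) (app (clos t s) (clos u s))
  /-- `(λ t)[s] → λ (t[⇑(s)])` -/
  | Lambda (t : Term) (s : Subst) : Rule (clos (lam t) s) (lam (clos t (lift s)))
  /-- `1[t/] → t` -/
  | FVar (t : Term) : Rule (clos (var 0) (slash t)) t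
  /-- `n+1[t/] → n` -/
  | RVar (n : ℕ) (t : Term) : Rule (clos (var (n + 1)) (slash t)) (var n)
  /-- `1[⇑(s)] → 1` -/
  | FVarLift (s : Subst) : Rule (clos (var 0) (lift s)) (var 0)
  /-- `n+1[⇑(s)] → n[s][↑]` -/
  | RVarLift (n : ℕ) (s : Subst) :
      Rule (clos (var (n + 1)) (lift s)) (clos (clos (var n) s) shift)
  /-- `n[↑] → n+1` -/
  | VarShift (n : ℕ) : Rule (clos (var n) shift) (var (n + 1))

mutual

/-- One-step reduction of terms: the rules closed under all term and substitution contexts. -/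
inductive Step : Term → Term → Prop
  | rule {t t' : Term} : Rule t t' → Step t t'
  | appL {t t' : Term} (u : Term) : Step t t' → Step (app t u) (app t' u)
  | appR (t : Term) {u u' : Term} : Step u u' → Step (app t u) (app t u')
  | lam {t t' : Term} : Step t t' → Step (lam t) (lam t')
  | closL {t t' : Term} (s : Subst) : Step t t' → Step (clos t s) (clos t' s)
  | closR (t : Term) {s s' : Subst} : SubstStep s s' → Step (clos t s) (clos t s')

/-- One-step reduction inside a substitution. -/
inductive SubstStep : Subst → Subst → Prop
  | slash {t t' : Term} : Step t t' → SubstStep (slash t) (slash t')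
  | lift {s s' : Subst} : SubstStep s s' → SubstStep (lift s) (lift s')

end

/-- A term is strongly normalizing if no infinite reduction sequence starts from it. -/
def StronglyNormalizing (t : Term) : Prop :=
  ¬ ∃ f : ℕ → Term, f 0 = t ∧ ∀ i, Step (f i) (f (i + 1))

/-- Simple types over a set `ι` of atomic types. -/
inductive Ty (ι : Type u) : Type u
  | atom (a : ι) : Ty ι
  | arrow (A B : Ty ι) : Ty ι

mutual

/-- The typing judgement `Γ ⊢ t : A`. A context is a list of types whose head is the type of the
first index. -/
inductive HasType {ι : Type u} : List (Ty ι) → Term → Ty ι → Prop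
  /-- `Γ, A, Δ ⊢ n : A` where `n = |Γ| + 1` -/
  | var (Γ Δ : List (Ty ι)) (A : Ty ι) : HasType (Γ ++ A :: Δ) (var Γ.length) A
  | app {Γ : List (Ty ι)} {t u : Term} {A B : Ty ι} :
      HasType Γ t (Ty.arrow B A) → HasType Γ u B → HasType Γ (app t u) A
  | lam {Γ : List (Ty ι)} {t : Term} {A B : Ty ι} :
      HasType (B :: Γ) t A → HasType Γ (lam t) (Ty.arrow B A)
  | clos {Γ Γ' : List (Ty ι)} {t : Term} {s : Subst} {A : Ty ι} :
      SubstHasType Γ s Γ' → HasType Γ' t A → HasType Γ (clos t s) A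

/-- The typing judgement `Γ ⊢ s ▷ Γ'` for substitutions. -/
inductive SubstHasType {ι : Type u} : List (Ty ι) → Subst → List (Ty ι) → Prop
  | slash {Γ : List (Ty ι)} {t : Term} {A : Ty ι} :
      HasType Γ t A → SubstHasType Γ (slash t) (A :: Γ)
  | shift (Γ : List (Ty ι)) (A : Ty ι) : SubstHasType (A :: Γ) shift Γ
  | lift {Γ Γ' : List (Ty ι)} {s : Subst} (A : Ty ι) :
      SubstHasType Γ s Γ' → SubstHasType (A :: Γ) (lift s) (A :: Γ')

end

end LambdaUpsilon

namespace LambdaUpsilon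

open Relation Term Subst

universe u

/-! ### Pure terms -/

/-- PureTerm `λ`-terms with De Bruijn indices. -/
inductive PureTerm : Type
  | var (n : ℕ) : PureTerm
  | app (M N : PureTerm) : PureTerm
  | lam (M : PureTerm) : PureTerm

namespace PureTerm

/-- Extension of a renaming under a binder. -/
def upRen (ρ : ℕ → ℕ) : ℕ → ℕ
  | 0 => 0
  | n + 1 => ρ n + 1

/-- Renaming of the free indices. -/
def rename : (ℕ → ℕ) → PureTerm → PureTerm
  | ρ, var n => var (ρ n)
  | ρ, app M N => app (rename ρ M) (rename ρ N)
  | ρ, lam M => lam (rename (upRen ρ) M)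

/-- Extension of a substitution under a binder. -/
def up (θ : ℕ → PureTerm) : ℕ → PureTerm
  | 0 => var 0
  | n + 1 => rename Nat.succ (θ n)

/-- Simultaneous substitution. -/
def subst : (ℕ → PureTerm) → PureTerm → PureTerm
  | θ, var n => θ n
  | θ, app M N => app (subst θ M) (subst θ N)
  | θ, lam M => lam (subst (up θ) M)

/-- The substitution sending index `0` to `N` and the index `n + 1` to `θ n`. -/
def cons (N : PureTerm) (θ : ℕ → PureTerm) : ℕ → PureTerm
  | 0 => N
  | n + 1 => θ n

theorem rename_eq_subst (M : PureTerm) : ∀ ρ, rename ρ M = subst (fun n => var (ρ n)) M := by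
  induction M with
  | var n => intro ρ; rfl
  | app M N hM hN => intro ρ; simp [rename, subst, hM, hN]
  | lam M hM =>
    intro ρ
    have h : (fun n => var (upRen ρ n)) = up fun n => var (ρ n) := by
      funext n; cases n <;> rfl
    simp [rename, subst, hM, h]

theorem subst_var (M : PureTerm) : subst var M = M := by
  induction M with
  | var n => rfl
  | app M N hM hN => simp [subst, hM, hN]
  | lam M hM =>
    have h : up var = var := by funext n; cases n <;> rfl
    simp [subst, h, hM]

theorem subst_rename (M : PureTerm) : ∀ ρ θ, subst θ (rename ρ M) = subst (fun n => θ (ρ n)) M := by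
  induction M with
  | var n => intro ρ θ; rfl
  | app M N hM hN => intro ρ θ; simp [rename, subst, hM, hN]
  | lam M hM =>
    intro ρ θ
    have h : (fun n => up θ (upRen ρ n)) = up fun n => θ (ρ n) := by
      funext n; cases n <;> rfl
    simp [rename, subst, hM, h]

theorem rename_rename (M : PureTerm) (ρ ρ' : ℕ → ℕ) :
    rename ρ' (rename ρ M) = rename (fun n => ρ' (ρ n)) M := by
  rw [rename_eq_subst, subst_rename, rename_eq_subst M]

theorem rename_subst (M : PureTerm) :
    ∀ ρ θ, rename ρ (subst θ M) = subst (fun n => rename ρ (θ n)) M := by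
  induction M with
  | var n => intro ρ θ; rfl
  | app M N hM hN => intro ρ θ; simp [rename, subst, hM, hN]
  | lam M hM =>
    intro ρ θ
    have h : (fun n => rename (upRen ρ) (up θ n)) = up fun n => rename ρ (θ n) := by
      funext n
      cases n with
      | zero => rfl
      | succ n => simp only [up, rename_rename]; rfl
    simp [rename, subst, hM, h]

theorem subst_subst (M : PureTerm) :
    ∀ θ η, subst η (subst θ M) = subst (fun n => subst η (θ n)) M := by
  induction M with
  | var n => intro θ η; rfl
  | app M N hM hN => intro θ η; simp [subst, hM, hN]
  | lam M hM =>
    intro θ η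
    have h : (fun n => subst (up η) (up θ n)) = up fun n => subst η (θ n) := by
      funext n
      cases n with
      | zero => rfl
      | succ n => simp only [up, subst_rename, rename_subst]
    simp [subst, hM, h]

theorem subst_cons_subst_up (M N : PureTerm) (θ : ℕ → PureTerm) :
    subst (cons N var) (subst (up θ) M) = subst (cons N θ) M := by
  rw [subst_subst]
  congr 1
  funext n
  cases n with
  | zero => rfl
  | succ n =>
    simp only [up, subst_rename]
    exact subst_var _

theorem subst_subst_cons (M N : PureTerm) (θ : ℕ → PureTerm) :
    subst θ (subst (cons N var) M) = subst (cons (subst θ N) var) (subst (up θ) M) := by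
  rw [subst_cons_subst_up, subst_subst]
  congr 1
  funext n
  cases n <;> rfl

/-! ### Reduction of pure terms -/

/-- One-step `β`-reduction. -/
inductive Beta : PureTerm → PureTerm → Prop
  | beta (M N : PureTerm) : Beta (app (lam M) N) (subst (cons N var) M)
  | appL {M M' : PureTerm} (N : PureTerm) : Beta M M' → Beta (app M N) (app M' N)
  | appR (M : PureTerm) {N N' : PureTerm} : Beta N N' → Beta (app M N) (app M N')
  | lam {M M' : PureTerm} : Beta M M' → Beta (lam M) (lam M')

theorem Beta.subst {M M' : PureTerm} (h : Beta M M') :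
    ∀ θ, Beta (subst θ M) (subst θ M') := by
  induction h with
  | beta M N => intro θ; rw [subst_subst_cons]; exact .beta _ _
  | appL N _ ih => exact fun θ => .appL _ (ih θ)
  | appR M _ ih => exact fun θ => .appR _ (ih θ)
  | lam _ ih => exact fun θ => .lam (ih _)

theorem Beta.rename {M M' : PureTerm} (h : Beta M M') (ρ : ℕ → ℕ) :
    Beta (rename ρ M) (rename ρ M') := by
  rw [rename_eq_subst, rename_eq_subst]
  exact h.subst _

/-- Many-step `β`-reduction. -/
abbrev Betas : PureTerm → PureTerm → Prop := ReflTransGen Beta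

theorem Betas.app {M M' N N' : PureTerm} (hM : Betas M M') (hN : Betas N N') :
    Betas (app M N) (app M' N') :=
  (hM.lift (fun x => PureTerm.app x N) fun _ _ => .appL N).trans
    (hN.lift (fun x => PureTerm.app M' x) fun _ _ => .appR M')

theorem Betas.lam {M M' : PureTerm} (hM : Betas M M') : Betas (lam M) (lam M') :=
  hM.lift PureTerm.lam fun _ _ => .lam

theorem Betas.subst {M M' : PureTerm} (h : Betas M M') (θ : ℕ → PureTerm) :
    Betas (subst θ M) (subst θ M') :=
  h.lift (PureTerm.subst θ) fun _ _ h => h.subst θ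

theorem Betas.rename {M M' : PureTerm} (h : Betas M M') (ρ : ℕ → ℕ) :
    Betas (rename ρ M) (rename ρ M') :=
  h.lift (PureTerm.rename ρ) fun _ _ h => h.rename ρ

theorem Betas.up {θ θ' : ℕ → PureTerm} (h : ∀ n, Betas (θ n) (θ' n)) :
    ∀ n, Betas (up θ n) (up θ' n)
  | 0 => .refl
  | n + 1 => (h n).rename _

theorem Betas.subst_right (M : PureTerm) :
    ∀ {θ θ' : ℕ → PureTerm}, (∀ n, Betas (θ n) (θ' n)) → Betas (PureTerm.subst θ M) (PureTerm.subst θ' M) := by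
  induction M with
  | var n => exact fun h => h n
  | app M N hM hN => exact fun h => (hM h).app (hN h)
  | lam M hM => exact fun h => (hM (Betas.up h)).lam

/-- Strong normalization for `β`-reduction. -/
abbrev SN : PureTerm → Prop := Acc fun N M => Beta M N

theorem SN.of_subst {M : PureTerm} {θ : ℕ → PureTerm} (h : SN (subst θ M)) : SN M :=
  Subrelation.accessible (fun h => Beta.subst h θ) (InvImage.accessible (subst θ) h)

/-- A `β`-step, or passing to an immediate subterm. -/
inductive Descend : PureTerm → PureTerm → Prop
  | beta {M N : PureTerm} : Beta M N → Descend M N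
  | appL (M N : PureTerm) : Descend (app M N) M
  | appR (M N : PureTerm) : Descend (app M N) N
  | lam (M : PureTerm) : Descend (lam M) M

theorem Betas.descend {M N : PureTerm} (h : Betas M N) : ReflTransGen Descend M N :=
  ReflTransGen.mono (fun _ _ => .beta) _ _ h

theorem acc_descend_of_beta (M : PureTerm)
    (h : ∀ N, Beta M N → Acc (fun N M => Descend M N) N) : Acc (fun N M => Descend M N) M := by
  induction M with
  | var n =>
    constructor
    rintro _ ⟨⟨⟩⟩
  | app M N ihM ihN =>
    constructor
    intro P hP
    cases hP with
    | beta hP => exact h _ hP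
    | appL => exact ihM fun M' hM => (h _ (.appL N hM)).inv (.appL _ _)
    | appR => exact ihN fun N' hN => (h _ (.appR M hN)).inv (.appR _ _)
  | lam M ih =>
    constructor
    intro P hP
    cases hP with
    | beta hP => exact h _ hP
    | lam => exact ih fun M' hM => (h _ (.lam hM)).inv (.lam _)

theorem SN.acc_descend {M : PureTerm} (h : SN M) : Acc (fun N M => Descend M N) M := by
  induction h with
  | intro M _ ih => exact acc_descend_of_beta M ih

/-! ### Reducibility -/

/-- Terms that are not abstractions. -/
def Neutral : PureTerm → Prop
  | lam _ => False
  | _ => True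

/-- The reducibility predicate of a simple type. -/
def Red {ι : Type u} : Ty ι → PureTerm → Prop
  | .atom _, M => SN M
  | .arrow A B, M => ∀ N, Red A N → Red B (app M N)

theorem red_properties {ι : Type u} (A : Ty ι) :
    (∀ M, Red A M → SN M) ∧ (∀ M N, Red A M → Beta M N → Red A N) ∧
      ∀ M, Neutral M → (∀ N, Beta M N → Red A N) → Red A M := by
  induction A with
  | atom a => exact ⟨fun _ h => h, fun _ _ h hb => h.inv hb, fun _ _ h => ⟨_, h⟩⟩
  | arrow A B ihA ihB =>
    obtain ⟨snA, stepA, neA⟩ := ihA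
    obtain ⟨snB, stepB, neB⟩ := ihB
    refine ⟨fun M hM => ?_, fun M N hM hb P hP => stepB _ _ (hM P hP) (.appL P hb),
      fun M hne hM P hP => ?_⟩
    · have h0 : Red A (var 0) := neA _ trivial fun N h => nomatch h
      exact Subrelation.accessible (fun h => Beta.appL (var 0) h)
        (InvImage.accessible (fun x => app x (var 0)) (snB _ (hM _ h0)))
    · induction snA P hP with
      | intro P _ ih =>
        refine neB _ trivial fun Q hQ => ?_
        cases hQ with
        | beta => exact hne.elim
        | appL _ h => exact hM _ h P hP
        | appR _ h => exact ih _ h (stepA _ _ hP h)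

variable {ι : Type u}

theorem Red.sn {A : Ty ι} {M : PureTerm} (h : Red A M) : SN M := (red_properties A).1 M h

theorem Red.step {A : Ty ι} {M N : PureTerm} (h : Red A M) (hb : Beta M N) : Red A N :=
  (red_properties A).2.1 M N h hb

theorem Red.of_neutral {A : Ty ι} {M : PureTerm} (hM : Neutral M) (h : ∀ N, Beta M N → Red A N) :
    Red A M :=
  (red_properties A).2.2 M hM h

theorem Red.var (A : Ty ι) (n : ℕ) : Red A (var n) :=
  .of_neutral trivial fun _ h => nomatch h

theorem Red.beta_expand {A B : Ty ι} {M : PureTerm} (hM : SN M)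
    (h : ∀ N, Red A N → Red B (PureTerm.subst (cons N PureTerm.var) M)) {N : PureTerm} (hN : Red A N) :
    Red B (app (lam M) N) := by
  induction hM generalizing N with
  | intro M _ ihM =>
    induction hN.sn with
    | intro N _ ihN =>
      refine .of_neutral trivial fun P hP => ?_
      cases hP with
      | beta => exact h N hN
      | appL _ hl =>
        cases hl with
        | lam hl => exact ihM _ hl (fun Q hQ => (h Q hQ).step (hl.subst _)) hN
      | appR _ hr => exact ihN _ hr (hN.step hr)

theorem Red.lam {A B : Ty ι} {M : PureTerm}
    (h : ∀ N, Red A N → Red B (PureTerm.subst (cons N PureTerm.var) M)) : Red (.arrow A B) (lam M) :=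
  fun _ hN => beta_expand (h _ (.var A 0)).sn.of_subst h hN

/-- Substitutions sending the indices of a context to reducible terms. -/
def RedSubst (Γ : List (Ty ι)) (θ : ℕ → PureTerm) : Prop :=
  ∀ n A, Γ[n]? = some A → Red A (θ n)

theorem RedSubst.cons {Γ : List (Ty ι)} {θ : ℕ → PureTerm} {A : Ty ι} {N : PureTerm}
    (hθ : RedSubst Γ θ) (hN : Red A N) : RedSubst (A :: Γ) (cons N θ)
  | 0, _, h => by cases h; exact hN
  | n + 1, B, h => hθ n B h

end PureTerm

/-! ### Interpretation of explicit substitutions -/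

open PureTerm

mutual

/-- The pure term obtained by carrying out all the substitutions. -/
def Term.eval : Term → PureTerm
  | .var n => .var n
  | .app t u => .app t.eval u.eval
  | .lam t => .lam t.eval
  | .clos t s => subst s.eval t.eval

/-- The simultaneous substitution denoted by an explicit one. -/
def Subst.eval : Subst → ℕ → PureTerm
  | .slash t => cons t.eval .var
  | .lift s => up s.eval
  | .shift => fun n => .var (n + 1)

end

theorem Rule.eval {t t' : Term} (h : Rule t t') : Betas t.eval t'.eval := by
  cases h with
  | B t u => exact .single (.beta _ _)
  | RVarLift n s =>
    simp only [Term.eval, Subst.eval, subst, up, rename_eq_subst]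
    exact .refl
  | _ => exact .refl

mutual

theorem Step.eval {t t' : Term} : Step t t' → Betas t.eval t'.eval
  | .rule h => h.eval
  | .appL _ h => h.eval.app .refl
  | .appR _ h => Betas.app .refl h.eval
  | .lam h => h.eval.lam
  | .closL _ h => h.eval.subst _
  | .closR _ h => Betas.subst_right _ h.eval

theorem SubstStep.eval {s s' : Subst} : SubstStep s s' → ∀ n, Betas (s.eval n) (s'.eval n)
  | .slash h => fun n => match n with
    | 0 => h.eval
    | _ + 1 => .refl
  | .lift h => Betas.up h.eval

end

mutual

theorem HasType.red {ι : Type u} {Γ : List (Ty ι)} {t : Term} {A : Ty ι} :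
    HasType Γ t A → ∀ θ, RedSubst Γ θ → Red A (subst θ t.eval)
  | .var Γ Δ A, θ, hθ => hθ _ A (by simp)
  | .app ht hu, θ, hθ => ht.red θ hθ _ (hu.red θ hθ)
  | .lam ht, θ, hθ => Red.lam fun N hN => by
    rw [subst_cons_subst_up]
    exact ht.red _ (hθ.cons hN)
  | .clos hs ht, θ, hθ => by
    rw [Term.eval, subst_subst]
    exact ht.red _ (hs.red θ hθ)

theorem SubstHasType.red {ι : Type u} {Γ Γ' : List (Ty ι)} {s : Subst} :
    SubstHasType Γ s Γ' → ∀ θ, RedSubst Γ θ → RedSubst Γ' fun n => subst θ (s.eval n)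
  | .slash ht, θ, hθ => fun n B h => match n with
    | 0 => by cases h; exact ht.red θ hθ
    | n + 1 => hθ n B h
  | .shift Γ A, θ, hθ => fun n B h => hθ (n + 1) B h
  | .lift A hs, θ, hθ => fun n B h => match n with
    | 0 => hθ 0 B h
    | n + 1 => by
      simp only [Subst.eval, up, subst_rename]
      exact hs.red (fun n => θ (n + 1)) (fun n C hC => hθ (n + 1) C hC) n B h

end

theorem HasType.sn_eval {ι : Type u} {Γ : List (Ty ι)} {t : Term} {A : Ty ι}
    (h : HasType Γ t A) : t.eval.SN := by
  have := h.red .var fun n A _ => Red.var A n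
  rw [subst_var] at this
  exact this.sn

/-! ### Strong normalization with explicit substitutions -/

/-- Accessibility form of strong normalization of terms. -/
abbrev Term.SN : Term → Prop := Acc fun t' t => Step t t'

/-- Accessibility form of strong normalization of substitutions. -/
abbrev Subst.SN : Subst → Prop := Acc fun s' s => SubstStep s s'

theorem Term.SN.stronglyNormalizing {t : Term} (h : t.SN) : StronglyNormalizing t := by
  induction h with
  | intro t _ ih =>
    rintro ⟨f, rfl, hf⟩
    exact ih _ (hf 0) ⟨fun i => f (i + 1), rfl, fun i => hf (i + 1)⟩

theorem Term.SN.of_app_left {t u : Term} (h : (app t u).SN) : t.SN :=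
  Subrelation.accessible (fun h => Step.appL u h) (InvImage.accessible (fun x => app x u) h)

theorem Term.SN.of_app_right {t u : Term} (h : (app t u).SN) : u.SN :=
  Subrelation.accessible (fun h => Step.appR t h) (InvImage.accessible (app t) h)

theorem Term.SN.of_lam {t : Term} (h : (lam t).SN) : t.SN :=
  Subrelation.accessible (fun h => Step.lam h) (InvImage.accessible lam h)

theorem Subst.SN.of_lift {s : Subst} (h : (lift s).SN) : s.SN :=
  Subrelation.accessible (fun h => SubstStep.lift h) (InvImage.accessible lift h)

theorem Subst.SN.of_slash {t : Term} (h : (slash t).SN) : t.SN :=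
  Subrelation.accessible (fun h => SubstStep.slash h) (InvImage.accessible slash h)

theorem Term.SN.var (n : ℕ) : (var n).SN := ⟨_, fun _ h => by cases h with | rule h => cases h⟩

theorem Term.SN.lam {t : Term} (h : t.SN) : (lam t).SN := by
  induction h with
  | intro t _ ih =>
    refine ⟨_, fun t' h => ?_⟩
    cases h with
    | rule h => cases h
    | lam h => exact ih _ h

theorem Subst.SN.lift {s : Subst} (h : s.SN) : (lift s).SN := by
  induction h with
  | intro s _ ih =>
    refine ⟨_, fun s' h => ?_⟩
    cases h with
    | lift h => exact ih _ h

theorem Term.SN.slash {t : Term} (h : t.SN) : (slash t).SN := by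
  induction h with
  | intro t _ ih =>
    refine ⟨_, fun s' h => ?_⟩
    cases h with
    | slash h => exact ih _ h

theorem Subst.SN.shift : shift.SN := ⟨_, fun _ h => nomatch h⟩

/-- The number of lifts heading a substitution. -/
def Subst.depth : Subst → ℕ
  | .lift s => s.depth + 1
  | _ => 0

theorem SubstStep.depth_eq : ∀ {s s' : Subst}, SubstStep s s' → s'.depth = s.depth
  | _, _, .slash _ => rfl
  | _, _, .lift h => congrArg Nat.succ h.depth_eq

/-- Up to a renaming, `M` descends to the pure term denoted by `t`. -/
def Dominates (M : PureTerm) (t : Term) : Prop :=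
  ∃ ρ, ReflTransGen Descend M (rename ρ t.eval)

theorem Dominates.step {M : PureTerm} {t t' : Term} (h : Dominates M t) (hs : Step t t') :
    Dominates M t' :=
  let ⟨ρ, h⟩ := h
  ⟨ρ, h.trans (hs.eval.rename ρ).descend⟩

/-- `M` descends to a pure term other than by zero steps, and that term dominates `t`. -/
def StrictlyDominates (M : PureTerm) (t : Term) : Prop :=
  ∃ N, TransGen Descend M N ∧ Dominates N t

theorem Dominates.app_left {M : PureTerm} {t u : Term} (h : Dominates M (app t u)) :
    StrictlyDominates M t :=
  let ⟨ρ, h⟩ := h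
  ⟨_, .tail' h (.appL _ _), ρ, .refl⟩

theorem Dominates.app_right {M : PureTerm} {t u : Term} (h : Dominates M (app t u)) :
    StrictlyDominates M u :=
  let ⟨ρ, h⟩ := h
  ⟨_, .tail' h (.appR _ _), ρ, .refl⟩

theorem Dominates.lam {M : PureTerm} {t : Term} (h : Dominates M (lam t)) :
    StrictlyDominates M t :=
  let ⟨ρ, h⟩ := h
  ⟨_, .tail' h (.lam _), upRen ρ, .refl⟩

theorem Dominates.beta {M : PureTerm} {t u : Term} (h : Dominates M (app (.lam t) u)) :
    StrictlyDominates M (clos t (slash u)) :=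
  let ⟨ρ, h⟩ := h
  ⟨_, .tail' h (.beta (Beta.rename (.beta _ _) ρ)), ρ, .refl⟩

theorem Dominates.of_shift {M : PureTerm} {t : Term} (h : Dominates M (clos t shift)) :
    Dominates M t := by
  obtain ⟨ρ, h⟩ := h
  refine ⟨fun n => ρ (n + 1), ?_⟩
  have e : (clos t shift).eval = rename Nat.succ t.eval := (rename_eq_subst _ _).symm
  rwa [e, rename_rename] at h

theorem Term.SN.app_of_strictlyDominates {M : PureTerm}
    (IH : ∀ t u, t.SN → u.SN → StrictlyDominates M (clos t (.slash u)) →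
      (clos t (.slash u)).SN)
    {t u : Term} (ht : t.SN) (hu : u.SN) (h : Dominates M (app t u)) : (app t u).SN := by
  induction ht generalizing u with
  | intro t ht iht =>
    induction hu with
    | intro u hu ihu =>
      refine ⟨_, fun v hv => ?_⟩
      have hd := h.step hv
      cases hv with
      | rule hr =>
        cases hr with
        | B t => exact IH t u (Term.SN.of_lam ⟨_, ht⟩) ⟨_, hu⟩ h.beta
      | appL _ h' => exact iht _ h' ⟨_, hu⟩ hd
      | appR _ h' => exact ihu _ h' hd

theorem Term.SN.clos_of_strictlyDominates {M : PureTerm}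
    (IH : ∀ t s, t.SN → s.SN → StrictlyDominates M (clos t s) → (clos t s).SN)
    (k : ℕ) {s : Subst} (hk : s.depth = k) (hs : s.SN) {t : Term} (ht : t.SN)
    (h : Dominates M (clos t s)) : (clos t s).SN := by
  induction k using Nat.strong_induction_on generalizing s t with
  | _ k ihk =>
  induction hs generalizing t with
  | intro s hs' ihs =>
  have hs : s.SN := ⟨_, hs'⟩
  induction ht with
  | intro t ht' iht =>
  have ht : t.SN := ⟨_, ht'⟩
  refine ⟨_, fun v hv => ?_⟩
  have hd := h.step hv
  cases hv with
  | closL _ h' => exact iht _ h' hd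
  | closR _ h' => exact ihs _ h' (h'.depth_eq.trans hk) ht hd
  | rule hr =>
    cases hr with
    | App a b =>
      exact app_of_strictlyDominates (fun t u ht hu => IH t _ ht hu.slash)
        (IH _ _ ht.of_app_left hs hd.app_left) (IH _ _ ht.of_app_right hs hd.app_right) hd
    | Lambda a => exact (IH _ _ ht.of_lam hs.lift hd.lam).lam
    | FVar => exact hs.of_slash
    | RVar n => exact Term.SN.var n
    | FVarLift => exact Term.SN.var 0
    | VarShift n => exact Term.SN.var _
    | RVarLift n s =>
      have hk : s.depth + 1 = k := hk
      exact ihk 0 (by omega) rfl .shift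
        (ihk s.depth (by omega) rfl hs.of_lift (.var n) hd.of_shift) hd

theorem Term.SN.clos_of_dominates {M : PureTerm} (hM : Acc (fun N M => TransGen Descend M N) M) :
    ∀ t s, t.SN → s.SN → Dominates M (clos t s) → (clos t s).SN := by
  induction hM with
  | intro M _ ih =>
    exact fun t s ht hs h => clos_of_strictlyDominates
      (fun t s ht hs ⟨N, hN, h⟩ => ih N hN t s ht hs h) _ rfl hs ht h

theorem PureTerm.SN.acc_transGen_descend {M : PureTerm} (h : M.SN) :
    Acc (fun N M => TransGen Descend M N) M :=
  Subrelation.accessible (fun h => transGen_swap.mp h) h.acc_descend.transGen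

theorem Dominates.refl (t : Term) : Dominates t.eval t := by
  refine ⟨id, ?_⟩
  rw [rename_eq_subst]
  exact (subst_var t.eval).symm ▸ .refl

theorem Term.SN.clos {t : Term} {s : Subst} (h : (clos t s).eval.SN) (ht : t.SN) (hs : s.SN) :
    (clos t s).SN :=
  clos_of_dominates h.acc_transGen_descend t s ht hs (.refl _)

theorem Term.SN.app {t u : Term} (h : (app t u).eval.SN) (ht : t.SN) (hu : u.SN) :
    (app t u).SN :=
  app_of_strictlyDominates (M := (Term.app t u).eval)
    (fun t _ ht hu ⟨_, hN, hd⟩ =>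
      clos_of_dominates (h.acc_transGen_descend.inv hN) t _ ht hu.slash hd)
    ht hu (.refl _)

mutual

theorem HasType.sn {ι : Type u} {Γ : List (Ty ι)} {t : Term} {A : Ty ι} :
    HasType Γ t A → t.SN
  | .var Γ _ _ => .var _
  | .app ht hu => Term.SN.app (HasType.app ht hu).sn_eval ht.sn hu.sn
  | .lam ht => ht.sn.lam
  | .clos hs ht => Term.SN.clos (HasType.clos hs ht).sn_eval ht.sn hs.sn

theorem SubstHasType.sn {ι : Type u} {Γ Γ' : List (Ty ι)} {s : Subst} :
    SubstHasType Γ s Γ' → s.SN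
  | .slash ht => ht.sn.slash
  | .shift _ _ => .shift
  | .lift _ hs => hs.sn.lift

end

end LambdaUpsilon

/-- Every simply typed term of the calculus is strongly normalizing. -/
theorem mainTheorem3 {ι : Type*} (Γ : List (LambdaUpsilon.Ty ι)) (t : LambdaUpsilon.Term)
    (A : LambdaUpsilon.Ty ι) (ht : LambdaUpsilon.HasType Γ t A) :
    LambdaUpsilon.StronglyNormalizing t :=
  ht.sn.stronglyNormalizing
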